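/- A \emph{mean-payoff parity game} consists of a finite set $Q$ of states partitioned into the states $Q_1$ of Player 1 and the states $Q_2$ of Player 2, an edge relation $E\subseteq Q\times Q$ such that every state has at least one successor, a weight function $w\colon E\to\mathbb R$, and a priority function $\chi\colon Q\to\mathbb N$. A \emph{play} is an infinite path $\rho=\rho(0)\rho(1)\cdots$ in $(Q,E)$. Its \emph{payoff} is $\liminf_{n\to\infty}\frac1n\sum_{i=0}^{n-1}w(\rho(i),\rho(i+1))$ if the least priority of a state occurring infinitely often in $\rho$ is even, and $-\infty$ otherwise. A \emph{strategy} of Player $i$ is a function $\sigma\colon Q^*Q_i\to Q$ with $(q,\sigma(\gamma q))\in E$ for all $\gamma\in Q^*$, $q\in Q_i$. It is \emph{memoryless} if $\sigma(\gamma q)=\sigma(q)$ always, and \emph{finite-memory} if the equivalence relation on $Q^*$ given by $\gamma_1\sim\gamma_2\iff\sigma(\gamma_1\gamma)=\sigma(\gamma_2\gamma)$ for all $\gamma\in Q^*Q_i$ has finite index. A play $\rho$ is \emph{consistent} with $\sigma$ if $\rho(k+1)=\sigma(\rho(0)\cdots\rho(k))$ whenever $\rho(k)\in Q_i$. The value $\mathrm{val}(\sigma,q_0)$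 of a strategy $\sigma$ of Player 1 (of Player 2) from $q_0$ is the infimum (the supremum) of the payoffs of the plays from $q_0$ that are consistent with $\sigma$. The lower value $\underline{\mathrm{val}}(q_0)$ is the supremum of $\mathrm{val}(\sigma,q_0)$ over all strategies $\sigma$ of Player 1, and the upper value $\overline{\mathrm{val}}(q_0)$ is the infimum of $\mathrm{val}(\tau,q_0)$ over all strategies $\tau$ of Player 2. A strategy of Player 1 (of Player 2) is \emph{optimal from $q_0$} if its value from $q_0$ equals $\underline{\mathrm{val}}(q_0)$ (equals $\overline{\mathrm{val}}(q_0)$), and \emph{optimal} if it is optimal from every state. \textbf{Theorem.} For every mean-payoff parity game: (1) the game is determined, i.e. $\underline{\mathrm{val}}(q)=\overline{\mathrm{val}}(q)$ for every state $q$; (2) Player 1 has an optimal strategy; (3) Player 2 has a memoryless optimal strategy. Moreover, optimal strategies of Player 1 need infinite memory in general: there is a mean-payoff parity game, all of whose states belong to Player 1, with a state from which no finite-memory strategy of Player 1 is optimal. -/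

import Mathlib

open Filter

/-- The two players. -/
inductive Player : Type
  | one
  | two

/-- A weighted game graph with state set `V`, to be used with `V` finite.  The states are
partitioned by `owner` into those of Player 1 and those of Player 2, and every state has a
successor.  Only the values of `weight` on edges are ever used. -/
structure WeightedGameGraph (V : Type*) where
  owner : V → Player
  Edge : V → V → Prop
  weight : V → V → ℝ
  exists_edge : ∀ q, ∃ q', Edge q q'

/-- A mean-payoff parity game: a weighted game graph with a priority function. -/
structure MeanPayoffParityGame (V : Type*) extends WeightedGameGraph V where
  priority : V → ℕ

namespace WeightedGameGraph

variable {V : Type*}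

/-- An infinite path of the graph. -/
def IsPlay (G : WeightedGameGraph V) (ρ : ℕ → V) : Prop :=
  ∀ n, G.Edge (ρ n) (ρ (n + 1))

/-- A strategy for player `i`: after the history `γ q` (a finite sequence `γ` of states followed
by a state `q` of player `i`), the state `move γ q` is chosen among the successors of `q`. -/
structure Strategy (G : WeightedGameGraph V) (i : Player) where
  move : List V → {q : V // G.owner q = i} → V
  edge_move : ∀ γ q, G.Edge q.1 (move γ q)

/-- The strategy depends on the current state only. -/
def Strategy.IsMemoryless {G : WeightedGameGraph V} {i : Player} (σ : G.Strategy i) : Prop :=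
  ∀ γ q, σ.move γ q = σ.move [] q

/-- Two sequences of states are equivalent if the strategy behaves identically after them, for
all continuations. -/
def Strategy.memorySetoid {G : WeightedGameGraph V} {i : Player} (σ : G.Strategy i) :
    Setoid (List V) where
  r γ₁ γ₂ := ∀ γ q, σ.move (γ₁ ++ γ) q = σ.move (γ₂ ++ γ) q
  iseqv :=
    { refl := fun _ _ _ => rfl
      symm := fun h γ q => (h γ q).symm
      trans := fun h₁ h₂ γ q => (h₁ γ q).trans (h₂ γ q) }

/-- The memory equivalence of the strategy has finite index. -/
def Strategy.IsFiniteMemory {G : WeightedGameGraph V} {i : Player} (σ : G.Strategy i) : Prop :=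
  Finite (Quotient σ.memorySetoid)

/-- The plays that start in `q₀` and are consistent with the strategy `σ`. -/
def outcomes (G : WeightedGameGraph V) {i : Player} (σ : G.Strategy i) (q₀ : V) :
    Set (ℕ → V) :=
  {ρ | G.IsPlay ρ ∧ ρ 0 = q₀ ∧
    ∀ (k : ℕ) (h : G.owner (ρ k) = i), ρ (k + 1) = σ.move ((List.range k).map ρ) ⟨ρ k, h⟩}

/-- The average weight of the first `n` transitions (`-∞` if `n = 0`). -/
noncomputable def payoffUpTo (G : WeightedGameGraph V) (ρ : ℕ → V) (n : ℕ) : EReal :=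
  if n = 0 then ⊥
  else (((1 / (n : ℝ)) * ∑ i ∈ Finset.range n, G.weight (ρ i) (ρ (i + 1)) : ℝ) : EReal)

end WeightedGameGraph

/-- The set of states that occur infinitely often in `ρ`. -/
def infOccurring {V : Type*} (ρ : ℕ → V) : Set V :=
  {q | ∃ᶠ n in atTop, ρ n = q}

namespace MeanPayoffParityGame

variable {V : Type*}

/-- The minimal priority occurring infinitely often is even. -/
def ParityWinning (G : MeanPayoffParityGame V) (ρ : ℕ → V) : Prop :=
  Even (sInf (G.priority '' infOccurring ρ))

open Classical in
/-- The payoff of a play. -/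
noncomputable def payoff (G : MeanPayoffParityGame V) (ρ : ℕ → V) : EReal :=
  if G.ParityWinning ρ then liminf (G.payoffUpTo ρ) atTop else ⊥

/-- The value of a strategy of Player 1 from `q₀`. -/
noncomputable def valOne (G : MeanPayoffParityGame V) (σ : G.Strategy Player.one) (q₀ : V) :
    EReal :=
  ⨅ ρ ∈ G.outcomes σ q₀, G.payoff ρ

/-- The value of a strategy of Player 2 from `q₀`. -/
noncomputable def valTwo (G : MeanPayoffParityGame V) (τ : G.Strategy Player.two) (q₀ : V) :
    EReal :=
  ⨆ ρ ∈ G.outcomes τ q₀, G.payoff ρ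

/-- The lower value of a state. -/
noncomputable def lowerVal (G : MeanPayoffParityGame V) (q₀ : V) : EReal :=
  ⨆ σ : G.Strategy Player.one, G.valOne σ q₀

/-- The upper value of a state. -/
noncomputable def upperVal (G : MeanPayoffParityGame V) (q₀ : V) : EReal :=
  ⨅ τ : G.Strategy Player.two, G.valTwo τ q₀

/-- Every state has a value. -/
def IsDetermined (G : MeanPayoffParityGame V) : Prop :=
  ∀ q₀, G.lowerVal q₀ = G.upperVal q₀

/-- Optimality of a Player 1 strategy from a given state. -/
def IsOptimalOneFrom (G : MeanPayoffParityGame V) (σ : G.Strategy Player.one) (q₀ : V) : Prop :=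
  G.valOne σ q₀ = G.lowerVal q₀

/-- Optimality of a Player 2 strategy from a given state. -/
def IsOptimalTwoFrom (G : MeanPayoffParityGame V) (τ : G.Strategy Player.two) (q₀ : V) : Prop :=
  G.valTwo τ q₀ = G.upperVal q₀

/-- Global optimality of a Player 1 strategy. -/
def IsOptimalOne (G : MeanPayoffParityGame V) (σ : G.Strategy Player.one) : Prop :=
  ∀ q₀, G.IsOptimalOneFrom σ q₀

/-- Global optimality of a Player 2 strategy. -/
def IsOptimalTwo (G : MeanPayoffParityGame V) (τ : G.Strategy Player.two) : Prop :=
  ∀ q₀, G.IsOptimalTwoFrom τ q₀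

end MeanPayoffParityGame

/-! The payoff is shift invariant and submixing: a shuffle of two paths pays at least the smaller of
their payoffs. Indeed its least recurring priority is the smaller of two even ones, and linear lower
bounds on the weight sums add up.

For such payoffs a solution with a memoryless strategy of Player 2 is built by induction on the
number of edges (`exists_isSolution`). If Player 2 has a choice at `x`, dividing the edges out of
`x` into two classes gives two smaller games. Player 2 commits to the one with the lower value at
`x`. Player 1 cuts the play at the visits to `x`, glues the pieces belonging to each game, and plays
in each glued path the strategy of that game; by submixing nothing is lost (`IsSolution.combine`).

If Player 2 has no choice, a path of maximal payoff is needed (`exists_max_payoff`). It runs through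
longer and longer pieces of better and better paths, all returning to one state of even priority.
Infinite memory is unavoidable here: in the example, the state of priority `0` must recur with
frequency tending to zero, while finite memory forces a periodic play. -/

namespace HalfPositional

variable {V : Type*}

/-! ### Solutions for an abstract payoff -/

/-- An infinite path of the relation `E`. -/
def IsPath (E : V → V → Prop) (ρ : ℕ → V) : Prop :=
  ∀ n, E (ρ n) (ρ (n + 1))

/-- The strategy `σ` of Player 1 and the memoryless strategy `τ` of Player 2 guarantee `val` in the
game with edge relation `E` and payoff `pay`. -/
structure IsSolution (owner : V → Player) (pay : (ℕ → V) → EReal) (E : V → V → Prop)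
    (val : V → EReal) (σ : List V → V → V) (τ : V → V) : Prop where
  edge_one : ∀ γ p, E p (σ γ p)
  edge_two : ∀ p, E p (τ p)
  val_le : ∀ ρ, IsPath E ρ →
    (∀ k, owner (ρ k) = Player.one → ρ (k + 1) = σ ((List.range k).map ρ) (ρ k)) →
    val (ρ 0) ≤ pay ρ
  le_val : ∀ ρ, IsPath E ρ → (∀ k, owner (ρ k) = Player.two → ρ (k + 1) = τ (ρ k)) →
    pay ρ ≤ val (ρ 0)

/-- The payoff does not change if the first state is deleted. -/
def ShiftInvariant (pay : (ℕ → V) → EReal) : Prop :=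
  ∀ ρ, pay (fun n => ρ (n + 1)) = pay ρ

/-- The payoff of a shuffle of two paths is at least the minimum of their payoffs.  The shuffled
paths are given by the set `P` of the times at which the first one moves. -/
def Submixing (pay : (ℕ → V) → EReal) : Prop :=
  ∀ (ρ : ℕ → V) (P : ℕ → Prop), (Set.ofPred P).Infinite → (Set.ofPred fun n => ¬ P n).Infinite →
    (∀ k, ρ (Nat.nth P (k + 1)) = ρ (Nat.nth P k + 1)) →
    (∀ k, ρ (Nat.nth (fun n => ¬ P n) (k + 1)) = ρ (Nat.nth (fun n => ¬ P n) k + 1)) →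
    min (pay (ρ ∘ Nat.nth P)) (pay (ρ ∘ Nat.nth fun n => ¬ P n)) ≤ pay ρ

theorem ShiftInvariant.add {pay : (ℕ → V) → EReal} (h : ShiftInvariant pay) (ρ : ℕ → V) (m : ℕ) :
    pay (fun n => ρ (n + m)) = pay ρ := by
  induction m with
  | zero => rfl
  | succ m ih =>
    rw [← ih, ← h (fun n => ρ (n + m))]
    congr 1
    funext n
    congr 1
    omega

/-- Carrying the history along with the current state turns the recursion into plain iteration. -/
theorem exists_outcome (s : List V → V → V) (q : V) :
    ∃ ρ : ℕ → V, ρ 0 = q ∧ ∀ k, ρ (k + 1) = s ((List.range k).map ρ) (ρ k) := by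
  let f : List V × V → List V × V := fun x => (x.1 ++ [x.2], s x.1 x.2)
  let u : ℕ → List V × V := fun n => f^[n] ([], q)
  have hu : ∀ n, u (n + 1) = f (u n) := fun n => Function.iterate_succ_apply' f n _
  have hl : ∀ n, (u n).1 = (List.range n).map (fun i => (u i).2) := by
    intro n
    induction n with
    | zero => rfl
    | succ n ih => rw [hu, List.range_succ, List.map_append, ← ih]; rfl
  refine ⟨fun n => (u n).2, rfl, fun k => ?_⟩
  rw [← hl]
  exact congrArg Prod.snd (hu k)

/-- The value does not decrease along a finite path that is consistent with the strategy of
Player 1. -/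
theorem IsSolution.val_le_of_prefix {owner : V → Player} {pay : (ℕ → V) → EReal}
    {E : V → V → Prop} {val : V → EReal} {σ : List V → V → V} {τ : V → V}
    (h : IsSolution owner pay E val σ τ) (hs : ShiftInvariant pay) (ρ : ℕ → V) (t : ℕ)
    (hE : ∀ k < t, E (ρ k) (ρ (k + 1)))
    (hσ : ∀ k < t, owner (ρ k) = Player.one → ρ (k + 1) = σ ((List.range k).map ρ) (ρ k)) :
    val (ρ 0) ≤ val (ρ t) := by
  classical
  -- Player 1 follows `σ` throughout, while Player 2 copies `ρ` up to time `t` and then switches to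
  -- `τ`. The payoff of this play lies between the two values.
  obtain ⟨π, h0, hπ⟩ := exists_outcome (fun γ p =>
    if owner p = Player.one then σ γ p
    else if γ.length < t then ρ (γ.length + 1) else τ p) (ρ 0)
  simp only [List.length_map, List.length_range] at hπ
  have hagree : ∀ k ≤ t, π k = ρ k := by
    intro k
    induction k using Nat.strong_induction_on with
    | _ k ih =>
      intro hk
      cases k with
      | zero => exact h0
      | succ k =>
        rw [hπ, ih k (by omega) (by omega)]
        split_ifs with h1 h2
        · rw [hσ k (by omega) h1]
          congr 1
          exact List.map_congr_left fun i hi =>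
            ih i (by have := List.mem_range.1 hi; omega) (by have := List.mem_range.1 hi; omega)
        · rfl
        · omega
  have hpath : IsPath E π := by
    intro k
    by_cases hk : k < t
    · rw [hagree k hk.le, hagree (k + 1) hk]; exact hE k hk
    · rw [hπ, if_neg hk]
      split_ifs
      · exact h.edge_one _ _
      · exact h.edge_two _
  have h1 : val (π 0) ≤ pay π := h.val_le π hpath fun k hk => by rw [hπ, if_pos hk]
  have h2 : pay (fun n => π (n + t)) ≤ val (π (0 + t)) := by
    refine h.le_val (fun n => π (n + t)) (fun n => ?_) fun k hk => ?_
    · have := hpath (n + t)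
      rwa [show n + t + 1 = n + 1 + t by omega] at this
    · rw [show k + 1 + t = k + t + 1 by omega, hπ, if_neg (by rw [hk]; simp), if_neg (by omega)]
  rw [hs.add, zero_add, hagree t le_rfl] at h2
  rw [h0] at h1
  exact h1.trans h2

/-! ### Splitting a play at the visits to a state -/

/-- The step of `ρ` at time `t` belongs to the first of two games which differ in the edges at `x`:
the last edge out of `x` leads to `A`, or `x` has not been visited. -/
def branch (x : V) (A : Set V) (ρ : ℕ → V) : ℕ → Prop
  | 0 => ρ 0 = x → ρ 1 ∈ A
  | t + 1 => (ρ (t + 1) = x ∧ ρ (t + 2) ∈ A) ∨ (ρ (t + 1) ≠ x ∧ branch x A ρ t)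

theorem branch_eq {x : V} {A : Set V} {ρ : ℕ → V} {t : ℕ} (h : ρ t = x) :
    branch x A ρ t ↔ ρ (t + 1) ∈ A := by
  cases t <;> simp [branch, h]

theorem branch_succ_of_ne {x : V} {A : Set V} {ρ : ℕ → V} {t : ℕ} (h : ρ (t + 1) ≠ x) :
    branch x A ρ (t + 1) ↔ branch x A ρ t := by
  simp [branch, h]

theorem branch_of_forall_ne {x : V} {A : Set V} {ρ : ℕ → V} {t : ℕ} (h : ∀ i ≤ t, ρ i ≠ x) :
    branch x A ρ t := by
  induction t with
  | zero => exact fun h0 => absurd h0 (h 0 le_rfl)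
  | succ t ih => exact (branch_succ_of_ne (h _ le_rfl)).2 (ih fun i hi => h i (by omega))

/-- Only at `x` does `branch` look one state ahead. As `ρ k ≠ x`, it never looks beyond time `k`, so
a player who moves at `ρ k` can compute it from the history. -/
theorem branch_congr {x : V} {A : Set V} {ρ π : ℕ → V} {k : ℕ} (h : ∀ i ≤ k, ρ i = π i)
    (hx : ρ k ≠ x) : ∀ i ≤ k, (branch x A ρ i ↔ branch x A π i) := by
  intro i
  induction i with
  | zero =>
    intro _
    by_cases h0 : ρ 0 = x
    · have : 1 ≤ k := by
        rcases Nat.eq_zero_or_pos k with rfl | hk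
        · exact absurd h0 hx
        · exact hk
      rw [branch_eq h0, branch_eq ((h 0 (by omega)) ▸ h0), h _ this]
    · have h0' : π 0 ≠ x := h 0 (by omega) ▸ h0
      simp [branch, h0, h0']
  | succ i ih =>
    intro hi
    by_cases h0 : ρ (i + 1) = x
    · have : i + 2 ≤ k := by
        rcases Nat.lt_or_ge (i + 1) k with hk | hk
        · exact hk
        · exact absurd (by rwa [show i + 1 = k by omega] at h0) hx
      rw [branch_eq h0, branch_eq ((h _ hi) ▸ h0), h _ this]
    · have h0' : π (i + 1) ≠ x := h _ hi ▸ h0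
      rw [branch_succ_of_ne h0, branch_succ_of_ne h0', ih (by omega)]

/-- Membership in `P` changes only at visits to `x`, and `Nat.nth P k` is the first time in `P`
after `s`. -/
theorem nth_eq_of_change {x : V} {ρ : ℕ → V} {P : ℕ → Prop} (hinf : (Set.ofPred P).Infinite)
    (hP : ∀ t, ρ (t + 1) ≠ x → (P (t + 1) ↔ P t)) {s k : ℕ} (hs : ¬ P s)
    (hlt : s < Nat.nth P k) (hmin : ∀ i < k, Nat.nth P i ≤ s) : ρ (Nat.nth P k) = x := by
  by_contra hne
  obtain ⟨m, hm⟩ : ∃ m, Nat.nth P k = m + 1 := ⟨Nat.nth P k - 1, by omega⟩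
  have hk : P (m + 1) := hm ▸ Nat.nth_mem_of_infinite hinf k
  have hPm : P m := (hP m (hm ▸ hne)).1 hk
  obtain ⟨j, hj⟩ : ∃ j, Nat.nth P j = m := by
    have := Nat.range_nth_of_infinite hinf
    have hmem : m ∈ Set.range (Nat.nth P) := by rw [this]; exact hPm
    exact hmem
  have hjk : j < k := (Nat.nth_lt_nth hinf).1 (by omega)
  have := hmin j hjk
  have hms : m = s := by omega
  exact hs (hms ▸ hPm)

/-- The play leaves `P` at `x` and reenters it at `x`, so the pieces glue to a path. -/
theorem nth_succ_eq {x : V} {ρ : ℕ → V} {P : ℕ → Prop} (hinf : (Set.ofPred P).Infinite)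
    (hP : ∀ t, ρ (t + 1) ≠ x → (P (t + 1) ↔ P t)) (k : ℕ) :
    ρ (Nat.nth P (k + 1)) = ρ (Nat.nth P k + 1) := by
  classical
  by_cases h : P (Nat.nth P k + 1)
  · congr 1
    have h1 := Nat.nth_count h
    rwa [Nat.count_succ, if_pos (Nat.nth_mem_of_infinite hinf k),
      Nat.count_nth_of_infinite hinf] at h1
  · have hx : ρ (Nat.nth P k + 1) = x := by
      by_contra hne
      exact h ((hP _ hne).2 (Nat.nth_mem_of_infinite hinf k))
    have hlt : Nat.nth P k < Nat.nth P (k + 1) := Nat.nth_strictMono hinf (Nat.lt_succ_self k)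
    rw [hx]
    refine nth_eq_of_change hinf hP h ?_ fun i hi => ?_
    · refine lt_of_le_of_ne hlt fun he => h ?_
      rw [he]
      exact Nat.nth_mem_of_infinite hinf _
    · have := (Nat.nth_strictMono hinf).monotone (Nat.lt_succ_iff.1 hi)
      omega

theorem nth_zero_eq {x : V} {ρ : ℕ → V} {P : ℕ → Prop} (hinf : (Set.ofPred P).Infinite)
    (hP : ∀ t, ρ (t + 1) ≠ x → (P (t + 1) ↔ P t)) (h0 : ¬ P 0) : ρ (Nat.nth P 0) = x := by
  refine nth_eq_of_change hinf hP h0 (Nat.pos_of_ne_zero fun h => h0 ?_) (by simp)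
  have := Nat.nth_mem_of_infinite hinf 0
  rwa [h] at this

theorem map_filter_range (ρ : ℕ → V) (P : ℕ → Prop) [DecidablePred P] (t : ℕ) :
    ((List.range t).filter fun i => P i).map ρ
      = (List.range (Nat.count P t)).map (ρ ∘ Nat.nth P) := by
  induction t with
  | zero => rfl
  | succ t ih =>
    rw [List.range_succ, List.filter_append, List.map_append, ih, Nat.count_succ]
    by_cases h : P t
    · simp [h, List.range_succ, Nat.nth_count h]
    · simp [h]

open Classical in
/-- Player 1 shuffles the strategies `σa` and `σb` according to `branch`. -/
noncomputable def shuffle (x : V) (A : Set V) (σa σb : List V → V → V) (γ : List V) (p : V) : V :=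
  let ρ : ℕ → V := fun i => (γ ++ [p]).getD i p
  if branch x A ρ γ.length then
    σa (((List.range γ.length).filter fun i => branch x A ρ i).map ρ) p
  else σb (((List.range γ.length).filter fun i => ¬ branch x A ρ i).map ρ) p

open Classical in
theorem shuffle_history {x : V} {A : Set V} {σa σb : List V → V → V} {ρ : ℕ → V} {k : ℕ}
    (hx : ρ k ≠ x) :
    shuffle x A σa σb ((List.range k).map ρ) (ρ k) =
      if branch x A ρ k then
        σa (((List.range k).filter fun i => branch x A ρ i).map ρ) (ρ k)
      else σb (((List.range k).filter fun i => ¬ branch x A ρ i).map ρ) (ρ k) := by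
  set π : ℕ → V := fun i => ((List.range k).map ρ ++ [ρ k]).getD i (ρ k) with hπ
  have h : ∀ i ≤ k, ρ i = π i := by
    intro i hi
    have : (List.range k).map ρ ++ [ρ k] = (List.range (k + 1)).map ρ := by
      rw [List.range_succ, List.map_append]; rfl
    simp only [hπ, this]
    rw [List.getD_eq_getElem _ _ (by simp; omega)]
    simp
  have hb := branch_congr (A := A) h hx
  unfold shuffle
  simp only [List.length_map, List.length_range, ← hπ]
  have e : ∀ (Q Q' : ℕ → Prop) [DecidablePred Q] [DecidablePred Q'], (∀ i ≤ k, (Q i ↔ Q' i)) →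
      ((List.range k).filter fun i => Q' i).map π = ((List.range k).filter fun i => Q i).map ρ := by
    intro Q Q' _ _ hQ
    have : ((List.range k).filter fun i => Q' i) = ((List.range k).filter fun i => Q i) :=
      List.filter_congr fun i hi => by
        simp only [hQ i (List.mem_range.1 hi).le]
    rw [this]
    refine List.map_congr_left fun i hi => ?_
    have := List.mem_range.1 (List.mem_of_mem_filter hi)
    exact (h i (by omega)).symm
  rw [e _ _ hb, e (fun i => ¬ branch x A ρ i) _ fun i hi => not_congr (hb i hi)]
  simp only [hb k le_rfl]

/-- If `P` is cofinite, the subpath and `ρ` have a common tail. -/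
theorem ShiftInvariant.comp_nth {pay : (ℕ → V) → EReal} (hs : ShiftInvariant pay) (ρ : ℕ → V)
    {P : ℕ → Prop} (hP : ¬ (Set.ofPred fun n => ¬ P n).Infinite) : pay (ρ ∘ Nat.nth P) = pay ρ := by
  classical
  obtain ⟨N, hN⟩ : ∃ N, ∀ n, N ≤ n → P n := by
    obtain ⟨N, hN⟩ := (Set.not_infinite.1 hP).bddAbove
    refine ⟨N + 1, fun n hn => ?_⟩
    by_contra h
    have := hN h
    omega
  have hc : ∀ i, Nat.count P (i + N) = i + Nat.count P N := by
    intro i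
    induction i with
    | zero => simp
    | succ i ih =>
      rw [show i + 1 + N = i + N + 1 by omega, Nat.count_succ, ih, if_pos (hN _ (by omega))]
      omega
  rw [← hs.add ρ N, ← hs.add _ (Nat.count P N)]
  congr 1
  funext i
  simp only [Function.comp]
  rw [← hc, Nat.nth_count (hN _ (by omega))]

/-- Two games that differ in the edges at a state `x` of Player 2 combine to a game in which
Player 2 may choose at `x`. -/
theorem IsSolution.combine {owner : V → Player} {pay : (ℕ → V) → EReal}
    (hs : ShiftInvariant pay) (hm : Submixing pay) {E : V → V → Prop} {x : V}
    (hx : owner x = Player.two) (A : Set V) {va vb : V → EReal} {σa σb : List V → V → V}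
    {τa τb : V → V}
    (ha : IsSolution owner pay (fun p q => E p q ∧ (p = x → q ∈ A)) va σa τa)
    (hb : IsSolution owner pay (fun p q => E p q ∧ (p = x → q ∉ A)) vb σb τb)
    (hab : va x ≤ vb x) :
    IsSolution owner pay E va (shuffle x A σa σb) τa := by
  classical
  refine ⟨fun γ p => ?_, fun p => (ha.edge_two p).1, fun ρ hρ hc => ?_, fun ρ hρ hc => ?_⟩
  · unfold shuffle
    simp only
    split_ifs
    · exact (ha.edge_one _ _).1
    · exact (hb.edge_one _ _).1
  · have hne : ∀ k, owner (ρ k) = Player.one → ρ k ≠ x := by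
      intro k hk h; rw [h, hx] at hk; exact Player.noConfusion hk
    replace hc := fun k hk => (hc k hk).trans (shuffle_history (hne k hk))
    set P : ℕ → Prop := branch x A ρ with hPdef
    have hP : ∀ t, ρ (t + 1) ≠ x → (P (t + 1) ↔ P t) := fun t ht => branch_succ_of_ne ht
    have hP' : ∀ t, ρ (t + 1) ≠ x → (¬ P (t + 1) ↔ ¬ P t) := fun t ht => not_congr (hP t ht)
    -- Until the first visit to `x` the play belongs to the first game and follows `σa`.
    have hreach : ∀ t, ρ t = x → va (ρ 0) ≤ va x := by
      intro t ht
      have hex : ∃ t, ρ t = x := ⟨t, ht⟩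
      have hfirst : ∀ k < Nat.find hex, ρ k ≠ x := fun k hk => Nat.find_min hex hk
      have hbr : ∀ k < Nat.find hex, P k := fun k hk =>
        branch_of_forall_ne fun i hi => hfirst i (by omega)
      have := ha.val_le_of_prefix hs ρ (Nat.find hex)
        (fun k hk => ⟨hρ k, fun h => absurd h (hfirst k hk)⟩) fun k hk ho => by
          rw [hc k ho, if_pos (hbr k hk), List.filter_eq_self.2]
          intro i hi
          exact decide_eq_true (hbr i (by have := List.mem_range.1 hi; omega))
      rwa [Nat.find_spec hex] at this
    have hva : (Set.ofPred P).Infinite → va (ρ 0) ≤ pay (ρ ∘ Nat.nth P) := by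
      intro hinf
      have h1 : va ((ρ ∘ Nat.nth P) 0) ≤ pay (ρ ∘ Nat.nth P) := by
        refine ha.val_le _ (fun j => ?_) fun j hj => ?_
        · simp only [Function.comp, nth_succ_eq hinf hP]
          exact ⟨hρ _, fun h => (branch_eq h).1 (Nat.nth_mem_of_infinite hinf j)⟩
        · simp only [Function.comp, nth_succ_eq hinf hP] at hj ⊢
          rw [hc _ hj, if_pos (Nat.nth_mem_of_infinite hinf j), map_filter_range,
            Nat.count_nth_of_infinite hinf]
      refine le_trans ?_ h1
      by_cases h0 : P 0
      · rw [Function.comp, Nat.nth_zero_of_zero h0]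
      · have hx0 := nth_zero_eq hinf hP h0
        rw [Function.comp, hx0]
        exact hreach _ hx0
    have hvb : (Set.ofPred fun n => ¬ P n).Infinite → va (ρ 0) ≤ pay (ρ ∘ Nat.nth fun n => ¬ P n) := by
      intro hinf
      have h1 : vb ((ρ ∘ Nat.nth fun n => ¬ P n) 0) ≤ pay (ρ ∘ Nat.nth fun n => ¬ P n) := by
        refine hb.val_le _ (fun j => ?_) fun j hj => ?_
        · simp only [Function.comp, nth_succ_eq hinf hP']
          exact ⟨hρ _, fun h => fun hA =>
            (Nat.nth_mem_of_infinite hinf j : ¬ P _) ((branch_eq h).2 hA)⟩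
        · simp only [Function.comp, nth_succ_eq hinf hP'] at hj ⊢
          rw [hc _ hj, if_neg (Nat.nth_mem_of_infinite hinf j : ¬ P _),
            map_filter_range ρ fun n => ¬ P n,
            Nat.count_nth_of_infinite hinf]
      refine le_trans ?_ h1
      -- Before any visit to `x`, `branch` holds by default, so the second subpath can only start at
      -- `x`.
      have hx0 : ρ (Nat.nth (fun n => ¬ P n) 0) = x := by
        by_cases h0 : P 0
        · exact nth_zero_eq hinf hP' (not_not.2 h0)
        · rw [Nat.nth_zero_of_zero h0]
          by_contra hne
          exact h0 fun h => absurd h hne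
      rw [Function.comp, hx0]
      exact (hreach _ hx0).trans hab
    by_cases hi : (Set.ofPred P).Infinite
    · by_cases hi' : (Set.ofPred fun n => ¬ P n).Infinite
      · exact (le_min (hva hi) (hvb hi')).trans
          (hm ρ P hi hi' (nth_succ_eq hi hP) (nth_succ_eq hi' hP'))
      · rw [← hs.comp_nth ρ hi']
        exact hva hi
    · have hi' : (Set.ofPred fun n => ¬ P n).Infinite :=
        (Set.not_infinite.1 hi).infinite_compl
      have h2 := hs.comp_nth ρ (P := fun n => ¬ P n) (by simpa only [not_not] using hi)
      rw [← h2]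
      exact hvb hi'
  · refine ha.le_val ρ (fun n => ⟨hρ n, fun h => ?_⟩) hc
    rw [hc n (h ▸ hx)]
    exact (ha.edge_two _).2 h

/-! ### Induction on the number of edges -/

/-- If Player 2 has no choice, then a best path from every state solves the game. -/
theorem exists_isSolution_of_unique {owner : V → Player} {pay : (ℕ → V) → EReal} {E : V → V → Prop}
    (hE : ∀ p, ∃ q, E p q)
    (hmax : ∀ q, ∃ ρ, IsPath E ρ ∧ ρ 0 = q ∧ ∀ π, IsPath E π → π 0 = q → pay π ≤ pay ρ)
    (huniq : ∀ p q q', owner p = Player.two → E p q → E p q' → q = q') :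
    ∃ val σ τ, IsSolution owner pay E val σ τ := by
  classical
  choose τ hτ using hE
  choose best hbest hbest0 hbestmax using hmax
  -- The head of the history tells which best path to follow and its length the position on it; `τ`
  -- serves only for legality off that path.
  let σ : List V → V → V := fun γ p =>
    if p = best ((γ ++ [p]).head (by simp)) γ.length then
      best ((γ ++ [p]).head (by simp)) (γ.length + 1) else τ p
  refine ⟨fun q => pay (best q), σ, τ, fun γ p => ?_, hτ, fun ρ hρ hc => ?_, fun ρ hρ _ =>
    hbestmax _ _ hρ rfl⟩
  · simp only [σ]
    split_ifs with h
    · nth_rw 1 [h]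
      exact hbest _ _
    · exact hτ p
  · have heq : ∀ k, ρ k = best (ρ 0) k := by
      intro k
      induction k with
      | zero => exact (hbest0 _).symm
      | succ k ih =>
        rcases ho : owner (ρ k) with _ | _
        · have hhead : ((List.range k).map ρ ++ [ρ k]).head (by simp) = ρ 0 := by
            cases k <;> simp [List.range_succ_eq_map]
          rw [hc k ho]
          simp only [σ, hhead, List.length_map, List.length_range]
          rw [if_pos ih]
        · exact huniq _ _ _ ho (hρ k) (ih ▸ hbest (ρ 0) k)
    rw [show best (ρ 0) = ρ from (funext heq).symm]

/-- Half-positional determinacy of games with a shift invariant and submixing payoff which has a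
maximum over the paths from every state of every graph. -/
theorem exists_isSolution [Finite V] (owner : V → Player) {pay : (ℕ → V) → EReal}
    (hs : ShiftInvariant pay) (hm : Submixing pay)
    (hmax : ∀ E : V → V → Prop, (∀ p, ∃ q, E p q) → ∀ q, ∃ ρ, IsPath E ρ ∧ ρ 0 = q ∧
      ∀ π, IsPath E π → π 0 = q → pay π ≤ pay ρ)
    (E : V → V → Prop) (hE : ∀ p, ∃ q, E p q) :
    ∃ val σ τ, IsSolution owner pay E val σ τ := by
  induction hn : Set.ncard {e : V × V | E e.1 e.2} using Nat.strong_induction_on generalizing E with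
  | _ n ih =>
    by_cases huniq : ∀ p q q', owner p = Player.two → E p q → E p q' → q = q'
    · exact exists_isSolution_of_unique hE (hmax E hE) huniq
    · push Not at huniq
      obtain ⟨x, y, y', hx, hy, hy', hne⟩ := huniq
      have key : ∀ (A : Set V) (z z' : V), E x z → E x z' → z ∈ A → z' ∉ A →
          ∃ val σ τ, IsSolution owner pay (fun p q => E p q ∧ (p = x → q ∈ A)) val σ τ := by
        intro A z z' hz hz' hzA hzA'
        refine ih _ ?_ _ (fun p => ?_) rfl
        · rw [← hn]
          refine Set.ncard_lt_ncard ⟨fun e he => he.1, fun h => ?_⟩ (Set.toFinite _)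
          exact hzA' ((h (show (x, z') ∈ {e : V × V | E e.1 e.2} from hz')).2 rfl)
        · by_cases hp : p = x
          · exact ⟨z, hp ▸ hz, fun _ => hzA⟩
          · obtain ⟨q, hq⟩ := hE p
            exact ⟨q, hq, fun h => absurd h hp⟩
      obtain ⟨va, σa, τa, ha⟩ := key {y} y y' hy hy' rfl (fun h => hne h.symm)
      obtain ⟨vb, σb, τb, hb⟩ := key {y}ᶜ y' y hy' hy (fun h => hne h.symm) (fun h => h rfl)
      rcases le_total (va x) (vb x) with h | h
      · exact ⟨_, _, _, IsSolution.combine hs hm hx {y} ha hb h⟩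
      · have ha' : IsSolution owner pay (fun p q => E p q ∧ (p = x → q ∉ ({y}ᶜ : Set V))) va σa τa := by
          simpa only [Set.mem_compl_iff, not_not] using ha
        exact ⟨_, _, _, IsSolution.combine hs hm hx {y}ᶜ hb ha' h⟩

end HalfPositional

/-! ### The mean-payoff parity payoff is shift invariant and submixing -/

namespace MeanPayoffParityGame

open HalfPositional

variable {V : Type*} (G : MeanPayoffParityGame V)

/-- The sum of the weights of the first `n` transitions. -/
noncomputable def weightSum (ρ : ℕ → V) (n : ℕ) : ℝ :=
  ∑ i ∈ Finset.range n, G.weight (ρ i) (ρ (i + 1))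

theorem weightSum_zero (ρ : ℕ → V) : G.weightSum ρ 0 = 0 := rfl

theorem weightSum_succ (ρ : ℕ → V) (n : ℕ) :
    G.weightSum ρ (n + 1) = G.weightSum ρ n + G.weight (ρ n) (ρ (n + 1)) :=
  Finset.sum_range_succ _ _

theorem weightSum_add (ρ : ℕ → V) (m n : ℕ) :
    G.weightSum ρ (m + n) = G.weightSum ρ m + G.weightSum (fun i => ρ (m + i)) n :=
  Finset.sum_range_add _ _ _

/-- Every partial sum is at least `c n` up to a constant and a small slope. -/
def HasMeanAtLeast (ρ : ℕ → V) (c : ℝ) : Prop :=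
  ∀ ε > 0, ∃ C, ∀ n : ℕ, (c - ε) * n - C ≤ G.weightSum ρ n

theorem exists_bound {a b : ℕ → ℝ} (h : ∀ᶠ n in atTop, a n ≤ b n) : ∃ C, ∀ n, a n - C ≤ b n := by
  obtain ⟨N, hN⟩ := eventually_atTop.1 h
  refine ⟨∑ i ∈ Finset.range N, |a i - b i|, fun n => ?_⟩
  rcases Nat.lt_or_ge n N with hn | hn
  · have := Finset.single_le_sum (f := fun i => |a i - b i|) (fun i _ => abs_nonneg _)
      (Finset.mem_range.2 hn)
    have := le_abs_self (a n - b n)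
    linarith
  · have : 0 ≤ ∑ i ∈ Finset.range N, |a i - b i| := Finset.sum_nonneg fun i _ => abs_nonneg _
    linarith [hN n hn]

theorem payoffUpTo_of_pos (ρ : ℕ → V) {n : ℕ} (hn : 0 < n) :
    G.payoffUpTo ρ n = ((G.weightSum ρ n / n : ℝ) : EReal) := by
  rw [WeightedGameGraph.payoffUpTo, if_neg hn.ne', weightSum, one_div, inv_mul_eq_div]

/-- The right side holds for all `n` and is additive in the weight sums, which makes it fit for
shuffles and concatenations. -/
theorem coe_le_liminf_iff (ρ : ℕ → V) (c : ℝ) :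
    (c : EReal) ≤ liminf (G.payoffUpTo ρ) atTop ↔ G.HasMeanAtLeast ρ c := by
  constructor
  · intro h ε hε
    have h1 : ((c - ε : ℝ) : EReal) < liminf (G.payoffUpTo ρ) atTop :=
      lt_of_lt_of_le (EReal.coe_lt_coe_iff.2 (by linarith)) h
    apply exists_bound
    filter_upwards [eventually_lt_of_lt_liminf h1, eventually_gt_atTop 0] with n hn hn0
    rw [G.payoffUpTo_of_pos ρ hn0, EReal.coe_lt_coe_iff,
      lt_div_iff₀ (by exact_mod_cast hn0)] at hn
    exact hn.le
  · intro h
    refine EReal.ge_of_forall_gt_iff_ge.1 fun y hy => ?_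
    rw [EReal.coe_lt_coe_iff] at hy
    obtain ⟨C, hC⟩ := h ((c - y) / 2) (by linarith)
    refine le_liminf_of_le (by isBoundedDefault) ?_
    obtain ⟨N, hN⟩ := exists_nat_gt (C / ((c - y) / 2))
    filter_upwards [eventually_gt_atTop 0, eventually_ge_atTop N] with n hn0 hn
    have hn0' : (0 : ℝ) < n := by exact_mod_cast hn0
    have hn' : (N : ℝ) ≤ n := by exact_mod_cast hn
    rw [G.payoffUpTo_of_pos ρ hn0, EReal.coe_le_coe_iff, le_div_iff₀ hn0']
    have h1 := hC n
    rw [div_lt_iff₀ (by linarith)] at hN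
    have h2 : (N : ℝ) * ((c - y) / 2) ≤ n * ((c - y) / 2) :=
      mul_le_mul_of_nonneg_right hn' (by linarith)
    nlinarith

theorem coe_le_payoff_iff (ρ : ℕ → V) (c : ℝ) :
    (c : EReal) ≤ G.payoff ρ ↔ G.ParityWinning ρ ∧ G.HasMeanAtLeast ρ c := by
  unfold payoff
  split_ifs with h
  · rw [coe_le_liminf_iff]; simp [h]
  · simp [h]

theorem exists_frequently_eq [Finite V] (ρ : ℕ → V) : ∃ s, ∃ᶠ n in atTop, ρ n = s := by
  by_contra h
  simp only [not_exists, not_frequently] at h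
  obtain ⟨n, hn⟩ := (eventually_all.2 h).exists
  exact hn _ rfl

theorem parityWinning_iff [Finite V] (ρ : ℕ → V) : G.ParityWinning ρ ↔
    ∃ s, Even (G.priority s) ∧ (∃ᶠ n in atTop, ρ n = s) ∧
      ∀ᶠ n in atTop, G.priority s ≤ G.priority (ρ n) := by
  constructor
  · intro h
    obtain ⟨s, hs, hs'⟩ := Nat.sInf_mem (s := G.priority '' infOccurring ρ)
      (Set.Nonempty.image _ (exists_frequently_eq ρ))
    refine ⟨s, by rwa [hs'], hs, ?_⟩
    have hinf : ∀ q, ∀ᶠ n in atTop, ρ n = q → q ∈ infOccurring ρ := by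
      intro q
      by_cases hq : q ∈ infOccurring ρ
      · exact Eventually.of_forall fun _ _ => hq
      · filter_upwards [not_frequently.1 hq] with n hn h
        exact absurd h hn
    filter_upwards [eventually_all.2 hinf] with n hn
    rw [hs']
    exact Nat.sInf_le ⟨_, hn _ rfl, rfl⟩
  · rintro ⟨s, he, hs, hall⟩
    have : sInf (G.priority '' infOccurring ρ) = G.priority s := by
      refine le_antisymm (Nat.sInf_le ⟨s, hs, rfl⟩) (le_csInf ⟨_, s, hs, rfl⟩ ?_)
      rintro _ ⟨q, hq, rfl⟩
      obtain ⟨n, rfl, hn⟩ := (hq.and_eventually hall).exists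
      exact hn
    rwa [ParityWinning, this]

theorem payoff_le_of_forall {ρ π : ℕ → V}
    (h : ∀ c : ℝ, (c : EReal) ≤ G.payoff ρ → (c : EReal) ≤ G.payoff π) :
    G.payoff ρ ≤ G.payoff π :=
  EReal.ge_of_forall_gt_iff_ge.1 fun c hc => h c hc.le

theorem parityWinning_shift (ρ : ℕ → V) :
    G.ParityWinning (fun n => ρ (n + 1)) ↔ G.ParityWinning ρ := by
  have : infOccurring (fun n => ρ (n + 1)) = infOccurring ρ := by
    ext q
    have := frequently_map (f := atTop) (m := fun n : ℕ => n + 1) (P := fun n => ρ n = q)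
    rw [map_add_atTop_eq_nat] at this
    exact this.symm
  rw [ParityWinning, this, ParityWinning]

theorem hasMeanAtLeast_shift (ρ : ℕ → V) (c : ℝ) :
    G.HasMeanAtLeast (fun n => ρ (n + 1)) c ↔ G.HasMeanAtLeast ρ c := by
  have key : ∀ n, G.weightSum ρ (n + 1) =
      G.weight (ρ 0) (ρ 1) + G.weightSum (fun n => ρ (n + 1)) n := fun n => by
    rw [weightSum, Finset.sum_range_succ', add_comm]; rfl
  refine forall₂_congr fun ε _ => ⟨fun ⟨C, hC⟩ => ?_, fun ⟨C, hC⟩ => ?_⟩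
  -- The absolute value covers the empty sum at `n = 0`.
  · refine ⟨|C - G.weight (ρ 0) (ρ 1) + (c - ε)|, fun n => ?_⟩
    have h2 := le_abs_self (C - G.weight (ρ 0) (ρ 1) + (c - ε))
    cases n with
    | zero => simp [weightSum_zero]
    | succ n =>
      have h1 := hC n
      rw [key]
      push_cast
      linarith
  · refine ⟨C - (c - ε) + G.weight (ρ 0) (ρ 1), fun n => ?_⟩
    have h1 := hC (n + 1)
    rw [key] at h1
    push_cast at h1
    linarith

theorem shiftInvariant_payoff : ShiftInvariant G.payoff := by
  intro ρ
  apply le_antisymm <;> refine G.payoff_le_of_forall fun c => ?_ <;>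
    simp only [coe_le_payoff_iff, parityWinning_shift, hasMeanAtLeast_shift, imp_self]

theorem weightSum_eq_shuffle {ρ : ℕ → V} {P : ℕ → Prop} [DecidablePred P]
    (h : ∀ k, ρ (Nat.nth P (k + 1)) = ρ (Nat.nth P k + 1))
    (h' : ∀ k, ρ (Nat.nth (fun n => ¬ P n) (k + 1)) = ρ (Nat.nth (fun n => ¬ P n) k + 1)) (n : ℕ) :
    G.weightSum ρ n = G.weightSum (ρ ∘ Nat.nth P) (Nat.count P n)
      + G.weightSum (ρ ∘ Nat.nth fun n => ¬ P n) (Nat.count (fun n => ¬ P n) n) := by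
  induction n with
  | zero => simp [weightSum_zero]
  | succ n ih =>
    rw [weightSum_succ, ih, Nat.count_succ, Nat.count_succ]
    by_cases hn : P n
    · simp only [hn, if_true, not_true, if_false, add_zero, weightSum_succ, Function.comp, h,
        Nat.nth_count]
      ring
    · have := Nat.nth_count (p := fun n => ¬ P n) hn
      simp only [hn, if_false, not_false_iff, if_true, add_zero, weightSum_succ, Function.comp, h',
        this]
      ring

theorem tendsto_nth {P : ℕ → Prop} (h : (Set.ofPred P).Infinite) :
    Tendsto (Nat.nth P) atTop atTop :=
  (Nat.nth_strictMono h).tendsto_atTop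

theorem eventually_nth {P Q : ℕ → Prop} (h : (Set.ofPred P).Infinite)
    (hQ : ∀ᶠ n in atTop, Q (Nat.nth P n)) : ∀ᶠ n in atTop, P n → Q n := by
  classical
  obtain ⟨N, hN⟩ := eventually_atTop.1 hQ
  filter_upwards [eventually_ge_atTop (Nat.nth P N)] with n hn hP
  have := hN (Nat.count P n) ((Nat.nth_strictMono h).le_iff_le.1 (by rwa [Nat.nth_count hP]))
  rwa [Nat.nth_count hP] at this

theorem submixing_payoff [Finite V] : Submixing G.payoff := by
  classical
  intro ρ P hP hP' hn hn'
  refine EReal.ge_of_forall_gt_iff_ge.1 fun c hc => ?_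
  obtain ⟨ha, hb⟩ := le_min_iff.1 hc.le
  obtain ⟨hap, ham⟩ := (G.coe_le_payoff_iff _ _).1 ha
  obtain ⟨hbp, hbm⟩ := (G.coe_le_payoff_iff _ _).1 hb
  refine (G.coe_le_payoff_iff _ _).2 ⟨?_, fun ε hε => ?_⟩
  · obtain ⟨s, hse, hsf, hsl⟩ := (G.parityWinning_iff _).1 hap
    obtain ⟨t, hte, htf, htl⟩ := (G.parityWinning_iff _).1 hbp
    have hsl' := eventually_nth (Q := fun n => G.priority s ≤ G.priority (ρ n)) hP hsl
    have htl' := eventually_nth (Q := fun n => G.priority t ≤ G.priority (ρ n)) hP' htl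
    rw [parityWinning_iff]
    rcases le_total (G.priority s) (G.priority t) with hst | hst
    · refine ⟨s, hse, (tendsto_nth hP).frequently hsf, ?_⟩
      filter_upwards [hsl', htl'] with n h1 h2
      by_cases hp : P n
      · exact h1 hp
      · exact hst.trans (h2 hp)
    · refine ⟨t, hte, (tendsto_nth hP').frequently htf, ?_⟩
      filter_upwards [hsl', htl'] with n h1 h2
      by_cases hp : P n
      · exact hst.trans (h1 hp)
      · exact h2 hp
  · obtain ⟨C, hC⟩ := ham ε hε
    obtain ⟨D, hD⟩ := hbm ε hε
    refine ⟨C + D, fun n => ?_⟩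
    have h3 : (n : ℝ) = Nat.count P n + Nat.count (fun n => ¬ P n) n := by
      have : n = Nat.count P n + Nat.count (fun n => ¬ P n) n := by
        induction n with
        | zero => simp
        | succ n ih =>
          rw [Nat.count_succ, Nat.count_succ]
          by_cases hp : P n
          · simp only [hp, if_true, not_true, if_false]; omega
          · simp only [hp, if_false, not_false_iff, if_true]; omega
      exact_mod_cast this
    have h1 := hC (Nat.count P n)
    have h2 := hD (Nat.count (fun n => ¬ P n) n)
    rw [G.weightSum_eq_shuffle hn hn', h3]
    linarith

end MeanPayoffParityGame

/-! ### Paths of maximal payoff -/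

namespace MeanPayoffParityGame

open HalfPositional

variable {V : Type*} (G : MeanPayoffParityGame V)

/-- Position `k` of the path number `n` is followed by position `k + 1`, or by the start of the next
path if the current one has come back to `s` and has run for long enough. -/
noncomputable def concatStep (s : V) (ρ : ℕ → ℕ → V) (T : ℕ → ℕ) (x : ℕ × ℕ) : ℕ × ℕ :=
  open Classical in
  if ρ x.1 (x.2 + 1) = s ∧ T x.1 ≤ x.2 + 1 then (x.1 + 1, 0) else (x.1, x.2 + 1)

/-- The path number and the position in this path at a given time. -/
noncomputable def concatPos (s : V) (ρ : ℕ → ℕ → V) (T : ℕ → ℕ) (t : ℕ) : ℕ × ℕ :=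
  (concatStep s ρ T)^[t] (0, 0)

section concat

variable {s : V} {ρ : ℕ → ℕ → V} {T : ℕ → ℕ}

local notation "u" => concatPos s ρ T

theorem concatPos_succ (t : ℕ) :
    (u (t + 1) = ((u t).1 + 1, 0) ∧ ρ (u t).1 ((u t).2 + 1) = s ∧ T (u t).1 ≤ (u t).2 + 1) ∨
    (u (t + 1) = ((u t).1, (u t).2 + 1) ∧
      ¬ (ρ (u t).1 ((u t).2 + 1) = s ∧ T (u t).1 ≤ (u t).2 + 1)) := by
  classical
  have h : u (t + 1) = concatStep s ρ T (u t) := Function.iterate_succ_apply' _ _ _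
  rw [h, concatStep]
  split_ifs with hc
  · exact Or.inl ⟨rfl, hc⟩
  · exact Or.inr ⟨rfl, hc⟩

theorem concat_succ (h0 : ∀ n, ρ n 0 = s) (t : ℕ) :
    ρ (u (t + 1)).1 (u (t + 1)).2 = ρ (u t).1 ((u t).2 + 1) := by
  rcases concatPos_succ (s := s) (ρ := ρ) (T := T) t with ⟨h, h', _⟩ | ⟨h, _⟩
  · rw [h, h', h0]
  · rw [h]

theorem concatPos_fst_mono : Monotone fun t => (u t).1 := by
  refine monotone_nat_of_le_succ fun t => ?_
  rcases concatPos_succ (s := s) (ρ := ρ) (T := T) t with ⟨h, _⟩ | ⟨h, _⟩ <;> simp [h]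

theorem exists_concatPos_next (hs : ∀ n, ∃ᶠ k in atTop, ρ n k = s) (t : ℕ) :
    ∃ t' > t, u t' = ((u t).1 + 1, 0) := by
  by_contra! hne
  have h : ∀ j, u (t + j) = ((u t).1, (u t).2 + j) := by
    intro j
    induction j with
    | zero => rfl
    | succ j ih =>
      rcases concatPos_succ (s := s) (ρ := ρ) (T := T) (t + j) with ⟨h, _⟩ | ⟨h, _⟩
      · rw [ih] at h
        exact absurd h (hne (t + j + 1) (by omega))
      · rw [ih] at h
        exact h
  obtain ⟨m, hm, hms⟩ := frequently_atTop.1 (hs (u t).1) (T (u t).1 + (u t).2 + 1)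
  obtain ⟨j, rfl⟩ : ∃ j, m = (u t).2 + j + 1 := ⟨m - ((u t).2 + 1), by omega⟩
  rcases concatPos_succ (s := s) (ρ := ρ) (T := T) (t + j) with ⟨h', _⟩ | ⟨_, h'⟩
  · rw [h j] at h'
    exact hne (t + j + 1) (by omega) h'
  · rw [h j] at h'
    exact h' ⟨hms, by simp only; omega⟩

theorem exists_le_concatPos_fst (hs : ∀ n, ∃ᶠ k in atTop, ρ n k = s) (N : ℕ) :
    ∃ t, N ≤ (u t).1 := by
  induction N with
  | zero => exact ⟨0, Nat.zero_le _⟩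
  | succ N ih =>
    obtain ⟨t, ht⟩ := ih
    obtain ⟨t', _, h⟩ := exists_concatPos_next hs t (T := T)
    exact ⟨t', by rw [h]; simp only; omega⟩

theorem concatPos_le (t : ℕ) : (u t).2 ≤ t ∧ ∀ m, (u t).1 = m + 1 → T m ≤ t := by
  induction t with
  | zero => simp [concatPos]
  | succ t ih =>
    rcases concatPos_succ (s := s) (ρ := ρ) (T := T) t with ⟨h, _, h'⟩ | ⟨h, _⟩
    · rw [h]
      refine ⟨Nat.zero_le _, fun m hm => ?_⟩
      obtain rfl : (u t).1 = m := Nat.succ.inj hm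
      omega
    · rw [h]
      exact ⟨Nat.succ_le_succ ih.1, fun m hm => (ih.2 m hm).trans (Nat.le_succ t)⟩

end concat

/-- Concatenating longer and longer pieces of better and better paths through `s` gives a path
which attains the supremum of their payoffs. -/
theorem exists_path_of_approx [Finite V] {E : V → V → Prop} {s : V} {r : ℝ}
    (hs : Even (G.priority s))
    (h : ∀ ε > 0, ∃ ρ, IsPath E ρ ∧ ρ 0 = s ∧ (∀ k, G.priority s ≤ G.priority (ρ k)) ∧
      (∃ᶠ k in atTop, ρ k = s) ∧ G.HasMeanAtLeast ρ (r - ε)) :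
    ∃ ρ, IsPath E ρ ∧ ρ 0 = s ∧ (r : EReal) ≤ G.payoff ρ := by
  have h' : ∀ n : ℕ, ∃ ρ, IsPath E ρ ∧ ρ 0 = s ∧ (∀ k, G.priority s ≤ G.priority (ρ k)) ∧
      (∃ᶠ k in atTop, ρ k = s) ∧
      ∃ C, ∀ k : ℕ, (r - 1 / ((n : ℝ) + 1)) * k - C ≤ G.weightSum ρ k := by
    intro n
    have hn : (0 : ℝ) < 1 / ((n : ℝ) + 1) := by positivity
    obtain ⟨ρ, h1, h2, h3, h4, h5⟩ := h (1 / ((n : ℝ) + 1) / 2) (by linarith)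
    refine ⟨ρ, h1, h2, h3, h4, ?_⟩
    have := h5 (1 / ((n : ℝ) + 1) / 2) (by linarith)
    rwa [sub_sub, add_halves] at this
  choose ρ hpath h0 hprio hfreq C hC using h'
  have hC0 : ∀ n, 0 ≤ C n := fun n => by
    have := hC n 0
    rw [weightSum_zero] at this
    push_cast at this
    linarith
  let B : ℕ → ℝ := fun n => ∑ i ∈ Finset.range (n + 1), C i
  have hBsucc : ∀ n, B (n + 1) = B n + C (n + 1) := fun n => Finset.sum_range_succ _ _
  have hB0 : ∀ n, 0 ≤ B n := fun n => Finset.sum_nonneg fun i _ => hC0 i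
  -- Path `n + 1` starts only when the elapsed time outweighs the accumulated constants `B (n + 1)`
  -- by a factor `n + 1`.
  let T : ℕ → ℕ := fun n => ⌈B (n + 1) * ((n : ℝ) + 1)⌉₊
  set u := concatPos s ρ T with hu
  have hBt : ∀ t, B (u t).1 * ((u t).1 : ℝ) ≤ t := by
    intro t
    rcases hn : (u t).1 with _ | m
    · simp
    · have h1 : T m ≤ t := (concatPos_le t).2 m hn
      have h2 : B (m + 1) * ((m : ℝ) + 1) ≤ T m := Nat.le_ceil _
      have h3 : (T m : ℝ) ≤ t := by exact_mod_cast h1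
      push_cast
      linarith
  let π : ℕ → V := fun t => ρ (u t).1 (u t).2
  have hπ : ∀ t, π (t + 1) = ρ (u t).1 ((u t).2 + 1) := concat_succ h0
  have hfreqπ : ∃ᶠ t in atTop, π t = s := by
    refine frequently_atTop.2 fun t => ?_
    obtain ⟨t', ht', h⟩ := exists_concatPos_next hfreq t (T := T)
    exact ⟨t', ht'.le, by simp only [π, hu]; rw [h, h0]⟩
  refine ⟨π, fun t => by rw [hπ]; exact hpath _ _, h0 _, (G.coe_le_payoff_iff _ _).2
    ⟨(G.parityWinning_iff _).2 ⟨s, hs, hfreqπ, Eventually.of_forall fun t => hprio _ _⟩,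
    fun ε hε => ?_⟩⟩
  obtain ⟨N, hN⟩ := exists_nat_gt (1 / (ε / 2))
  rw [div_lt_iff₀ (by linarith)] at hN
  obtain ⟨t₀, ht₀⟩ := exists_le_concatPos_fst hfreq N (T := T)
  have hphase : ∀ t ≥ t₀, (N : ℝ) ≤ (u t).1 := fun t ht => by
    exact_mod_cast ht₀.trans (concatPos_fst_mono ht)
  have hsum : ∀ t ≥ t₀, ∀ k : ℕ,
      0 ≤ G.weightSum (ρ (u t).1) k - (r - ε / 2) * k + C (u t).1 := by
    intro t ht k
    have h1 := hC (u t).1 k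
    have h2 : 1 / (((u t).1 : ℝ) + 1) ≤ ε / 2 := by
      rw [div_le_iff₀ (by positivity)]
      nlinarith [hphase t ht]
    have h3 : 1 / (((u t).1 : ℝ) + 1) * k ≤ ε / 2 * k :=
      mul_le_mul_of_nonneg_right h2 (Nat.cast_nonneg k)
    nlinarith
  -- The bracket is the surplus of the current piece. When the piece ends it is nonnegative by
  -- `hsum` and can be dropped; the new one starts at `C`, which the increase of `B` cancels.
  obtain ⟨K, hK⟩ : ∃ K, ∀ t ≥ t₀, (r - ε / 2) * t - K - B (u t).1 +
      (G.weightSum (ρ (u t).1) (u t).2 - (r - ε / 2) * (u t).2 + C (u t).1) ≤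
        G.weightSum π t := by
    refine ⟨(r - ε / 2) * t₀ - B (u t₀).1 + (G.weightSum (ρ (u t₀).1) (u t₀).2
      - (r - ε / 2) * (u t₀).2 + C (u t₀).1) - G.weightSum π t₀, fun t ht => ?_⟩
    induction t, ht using Nat.le_induction with
    | base => linarith
    | succ t ht ih =>
      have hw : G.weightSum π (t + 1) = G.weightSum π t +
          (G.weightSum (ρ (u t).1) ((u t).2 + 1) - G.weightSum (ρ (u t).1) (u t).2) := by
        rw [weightSum_succ, weightSum_succ, hπ]
        ring
      have hnn := hsum t ht ((u t).2 + 1)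
      rw [hw]
      push_cast at hnn ⊢
      rcases concatPos_succ (s := s) (ρ := ρ) (T := T) t with ⟨h, _⟩ | ⟨h, _⟩
      · rw [← hu] at h
        rw [h]
        simp only [hBsucc, weightSum_zero]
        push_cast
        linarith
      · rw [← hu] at h
        rw [h]
        push_cast
        linarith
  obtain ⟨D, hD⟩ : ∃ D, ∀ n : ℕ, ((r - ε) * n - K) - D ≤ G.weightSum π n := by
    apply exists_bound
    filter_upwards [eventually_ge_atTop t₀] with t ht
    have h1 := hK t ht
    have h2 := hsum t ht (u t).2
    have h3 : B (u t).1 ≤ ε / 2 * t := by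
      have h4 : 1 ≤ (u t).1 * (ε / 2) := by nlinarith [hphase t ht]
      nlinarith [hBt t, hB0 (u t).1, mul_le_mul_of_nonneg_left h4 (hB0 (u t).1)]
    linarith
  exact ⟨K + D, fun n => by linarith [hD n]⟩

theorem exists_forall_le_of_hasMeanAtLeast [Finite V] :
    ∃ M : ℝ, ∀ ρ c, G.HasMeanAtLeast ρ c → c ≤ M := by
  obtain ⟨M, hM⟩ := (Set.finite_range fun x : V × V => G.weight x.1 x.2).bddAbove
  refine ⟨M, fun ρ c h => le_of_forall_pos_le_add fun ε hε => ?_⟩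
  obtain ⟨C, hC⟩ := h (ε / 2) (by linarith)
  have hw : ∀ n : ℕ, G.weightSum ρ n ≤ n * M := fun n => by
    have := Finset.sum_le_card_nsmul (Finset.range n) (fun i => G.weight (ρ i) (ρ (i + 1))) M
      fun i _ => hM ⟨(ρ i, ρ (i + 1)), rfl⟩
    rw [weightSum]
    simpa using this
  by_contra! hlt
  obtain ⟨n, hn⟩ := exists_nat_gt (C / (ε / 2))
  rw [div_lt_iff₀ (by linarith)] at hn
  nlinarith [hC n, hw n, (Nat.cast_nonneg n : (0 : ℝ) ≤ n)]

/-- In a finite graph, every state is the start of a path of maximal payoff. -/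
theorem exists_max_payoff [Finite V] (E : V → V → Prop) (hE : ∀ p, ∃ q, E p q) (q : V) :
    ∃ ρ, IsPath E ρ ∧ ρ 0 = q ∧ ∀ π, IsPath E π → π 0 = q → G.payoff π ≤ G.payoff ρ := by
  have hshift := G.shiftInvariant_payoff
  choose next hnext using hE
  obtain ⟨ρ₀, hρ₀, hρ₀'⟩ := exists_outcome (fun _ p => next p) q
  have hpath₀ : IsPath E ρ₀ := fun n => by rw [hρ₀']; exact hnext _
  have hle : ∀ π, IsPath E π → π 0 = q →
      G.payoff π ≤ sSup (G.payoff '' {π | IsPath E π ∧ π 0 = q}) :=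
    fun π h1 h2 => le_sSup ⟨π, ⟨h1, h2⟩, rfl⟩
  have hlt : ∀ c < sSup (G.payoff '' {π | IsPath E π ∧ π 0 = q}),
      ∃ π, IsPath E π ∧ π 0 = q ∧ c < G.payoff π := by
    intro c hc
    obtain ⟨_, ⟨π, ⟨h1, h2⟩, rfl⟩, h3⟩ := lt_sSup_iff.1 hc
    exact ⟨π, h1, h2, h3⟩
  generalize sSup (G.payoff '' {π | IsPath E π ∧ π 0 = q}) = v at hle hlt
  induction v using EReal.rec with
  | bot => exact ⟨ρ₀, hpath₀, hρ₀, fun π h1 h2 => (hle π h1 h2).trans bot_le⟩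
  | top =>
    obtain ⟨M, hM⟩ := G.exists_forall_le_of_hasMeanAtLeast
    obtain ⟨π, -, -, h⟩ := hlt ((M + 1 : ℝ) : EReal) (EReal.coe_lt_top _)
    linarith [hM _ _ ((G.coe_le_payoff_iff _ _).1 h.le).2]
  | coe r =>
    let Q : ℝ → V → Prop := fun ε s => Even (G.priority s) ∧
      (∃ π, IsPath E π ∧ π 0 = q ∧ ∃ m, π m = s) ∧
      ∃ ρ, IsPath E ρ ∧ ρ 0 = s ∧ (∀ k, G.priority s ≤ G.priority (ρ k)) ∧
        (∃ᶠ k in atTop, ρ k = s) ∧ ((r - ε : ℝ) : EReal) ≤ G.payoff ρ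
    have hQmono : ∀ ε ε' s, ε ≤ ε' → Q ε s → Q ε' s := by
      rintro ε ε' s hε ⟨h1, h2, ρ, h3, h4, h5, h6, h7⟩
      exact ⟨h1, h2, ρ, h3, h4, h5, h6,
        (EReal.coe_le_coe_iff.2 (by linarith)).trans h7⟩
    have hQex : ∀ ε > 0, ∃ s, Q ε s := by
      intro ε hε
      obtain ⟨π, h1, h2, h3⟩ := hlt ((r - ε : ℝ) : EReal) (EReal.coe_lt_coe_iff.2 (by linarith))
      obtain ⟨s, hs1, hs2, hs3⟩ :=
        (G.parityWinning_iff _).1 ((G.coe_le_payoff_iff _ _).1 h3.le).1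
      obtain ⟨N, hN⟩ := eventually_atTop.1 hs3
      obtain ⟨m, hm, hms⟩ := frequently_atTop.1 hs2 N
      refine ⟨s, hs1, ⟨π, h1, h2, m, hms⟩, fun n => π (n + m), fun n => ?_, ?_,
        fun k => hN _ (by omega), ?_, ?_⟩
      · have := h1 (n + m)
        rwa [show n + m + 1 = n + 1 + m by omega] at this
      · simpa using hms
      · rw [← map_add_atTop_eq_nat m, frequently_map] at hs2
        exact hs2
      · rw [hshift.add]
        exact h3.le
    -- Otherwise every state fails for some `ε`; as `Q` is monotone in `ε`, all states fail for the
    -- least of these finitely many.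
    obtain ⟨s, hs⟩ : ∃ s, ∀ ε > 0, Q ε s := by
      by_contra! hcon
      choose e he hQe using hcon
      have : Nonempty V := ⟨q⟩
      obtain ⟨x₀, hx₀⟩ := Finite.exists_min e
      obtain ⟨s, hs⟩ := hQex (e x₀) (he x₀)
      exact hQe s (hQmono _ _ _ (hx₀ s) hs)
    obtain ⟨h1, ⟨π, hπ, hπ0, m, hm⟩, -⟩ := hs 1 one_pos
    obtain ⟨ρ, hρ, hρ0, hρr⟩ := G.exists_path_of_approx (E := E) (r := r) h1 fun ε hε => by
      obtain ⟨-, -, ρ, h3, h4, h5, h6, h7⟩ := hs ε hε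
      exact ⟨ρ, h3, h4, h5, h6, ((G.coe_le_payoff_iff _ _).1 h7).2⟩
    let κ : ℕ → V := fun i => if i < m then π i else ρ (i - m)
    have hκ : (fun n => κ (n + m)) = ρ := by
      funext n
      simp [κ]
    refine ⟨κ, fun n => ?_, ?_, fun π' h1 h2 => ?_⟩
    · rcases lt_trichotomy (n + 1) m with h | h | h
      · simp only [κ, if_pos h, if_pos ((Nat.lt_succ_self n).trans h)]
        exact hπ n
      · have := hπ n
        simp only [κ, if_pos (show n < m by omega), h, lt_irrefl, if_false, Nat.sub_self,
          hρ0, ← hm]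
        rwa [h] at this
      · simp only [κ, if_neg (show ¬ n < m by omega), if_neg (show ¬ n + 1 < m by omega)]
        rw [show n + 1 - m = n - m + 1 by omega]
        exact hρ _
    · rcases Nat.eq_zero_or_pos m with rfl | h
      · simp [κ, hρ0, ← hm, hπ0]
      · simp [κ, h, hπ0]
    · refine (hle π' h1 h2).trans (hρr.trans ?_)
      rw [← hshift.add κ m, hκ]

/-! ### Determinacy and optimal strategies -/

theorem exists_isSolution_payoff [Finite V] :
    ∃ val σ τ, IsSolution G.owner G.payoff G.Edge val σ τ :=
  exists_isSolution G.owner G.shiftInvariant_payoff G.submixing_payoff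
    (fun E hE q => G.exists_max_payoff E hE q) G.Edge G.exists_edge

theorem exists_mem_outcomes (σ : G.Strategy Player.one) (τ : G.Strategy Player.two) (q : V) :
    ∃ ρ, ρ ∈ G.outcomes σ q ∧ ρ ∈ G.outcomes τ q := by
  classical
  obtain ⟨ρ, h0, hρ⟩ := exists_outcome (fun γ p =>
    if h : G.owner p = Player.one then σ.move γ ⟨p, h⟩
    else if h : G.owner p = Player.two then τ.move γ ⟨p, h⟩ else p) q
  have h1 : ∀ k (h : G.owner (ρ k) = Player.one),
      ρ (k + 1) = σ.move ((List.range k).map ρ) ⟨ρ k, h⟩ := fun k h => by rw [hρ, dif_pos h]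
  have h2 : ∀ k (h : G.owner (ρ k) = Player.two),
      ρ (k + 1) = τ.move ((List.range k).map ρ) ⟨ρ k, h⟩ := fun k h => by
    rw [hρ, dif_neg (by rw [h]; simp), dif_pos h]
  have hp : G.IsPlay ρ := by
    intro k
    rcases ho : G.owner (ρ k) with _ | _
    · rw [h1 k ho]; exact σ.edge_move _ ⟨ρ k, ho⟩
    · rw [h2 k ho]; exact τ.edge_move _ ⟨ρ k, ho⟩
  exact ⟨ρ, ⟨hp, h0, h1⟩, hp, h0, h2⟩

theorem lowerVal_le_upperVal (q : V) : G.lowerVal q ≤ G.upperVal q := by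
  refine iSup_le fun σ => le_iInf fun τ => ?_
  obtain ⟨ρ, h1, h2⟩ := G.exists_mem_outcomes σ τ q
  exact (iInf₂_le ρ h1).trans (le_iSup₂ (f := fun ρ _ => G.payoff ρ) ρ h2)

theorem determined_and_optimal [Finite V] : G.IsDetermined ∧
    (∃ σ : G.Strategy Player.one, G.IsOptimalOne σ) ∧
    (∃ τ : G.Strategy Player.two, τ.IsMemoryless ∧ G.IsOptimalTwo τ) := by
  obtain ⟨val, σ, τ, h⟩ := G.exists_isSolution_payoff
  let σ' : G.Strategy Player.one := ⟨fun γ q => σ γ q.1, fun γ q => h.edge_one γ q.1⟩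
  let τ' : G.Strategy Player.two := ⟨fun _ q => τ q.1, fun _ q => h.edge_two q.1⟩
  have h1 : ∀ q, val q ≤ G.valOne σ' q := fun q =>
    le_iInf₂ fun ρ hρ => hρ.2.1 ▸ h.val_le ρ hρ.1 hρ.2.2
  have h2 : ∀ q, G.valTwo τ' q ≤ val q := fun q =>
    iSup₂_le fun ρ hρ => hρ.2.1 ▸ h.le_val ρ hρ.1 hρ.2.2
  have h3 : ∀ q, G.valOne σ' q ≤ G.lowerVal q := fun q => le_iSup (fun σ => G.valOne σ q) σ'
  have h4 : ∀ q, G.upperVal q ≤ G.valTwo τ' q := fun q => iInf_le (fun τ => G.valTwo τ q) τ'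
  have h5 := G.lowerVal_le_upperVal
  refine ⟨fun q => ?_, ⟨σ', fun q => ?_⟩, τ', fun _ _ => rfl, fun q => ?_⟩
  · exact le_antisymm (h5 q) ((h4 q).trans ((h2 q).trans ((h1 q).trans (h3 q))))
  · exact le_antisymm (h3 q) ((h5 q).trans ((h4 q).trans ((h2 q).trans (h1 q))))
  · exact le_antisymm ((h2 q).trans ((h1 q).trans ((h3 q).trans (h5 q)))) (h4 q)

end MeanPayoffParityGame

/-! ### Player 1 needs infinite memory -/

namespace MeanPayoffParityGame

open HalfPositional

/-- The state `true` has priority `1` and a loop, its transitions have weight `1`.  The state `false`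
has priority `0`, its only transition leads to `true` and has weight `0`. -/
noncomputable def infiniteMemoryGame : MeanPayoffParityGame Bool where
  owner _ := Player.one
  Edge p q := p = true ∨ q = true
  weight p _ := if p then 1 else 0
  exists_edge _ := ⟨true, Or.inr rfl⟩
  priority p := if p then 1 else 0

theorem infiniteMemoryGame_weightSum_le (ρ : ℕ → Bool) (n : ℕ) : infiniteMemoryGame.weightSum ρ n ≤ n := by
  induction n with
  | zero => simp [weightSum_zero]
  | succ n ih =>
    have : infiniteMemoryGame.weight (ρ n) (ρ (n + 1)) ≤ 1 := by
      simp only [infiniteMemoryGame]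
      split_ifs <;> norm_num
    rw [weightSum_succ]
    push_cast
    linarith

theorem infiniteMemoryGame_weightSum_succ_le {ρ : ℕ → Bool} (h : ρ 0 = false) (n : ℕ) :
    infiniteMemoryGame.weightSum ρ (n + 1) ≤ n := by
  have h1 : infiniteMemoryGame.weightSum ρ 1 = 0 := by
    rw [weightSum, Finset.sum_range_one, h]; simp [infiniteMemoryGame]
  rw [add_comm, weightSum_add, h1, zero_add]
  exact infiniteMemoryGame_weightSum_le _ _

/-- Visiting `false` once every `n` steps satisfies parity and loses one unit of weight per `n`
steps. -/
theorem infiniteMemoryGame_exists_play (n : ℕ) (hn : 2 ≤ n) :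
    ∃ ρ, infiniteMemoryGame.IsPlay ρ ∧ ρ 0 = true ∧ ((1 - 1 / n : ℝ) : EReal) ≤ infiniteMemoryGame.payoff ρ := by
  have hdvd : ∀ k, n ∣ k → ¬ n ∣ k + 1 := fun k h h' => by
    have := Nat.le_of_dvd one_pos ((Nat.dvd_add_right h).1 h')
    omega
  let ρ : ℕ → Bool := fun i => decide (¬ n ∣ i + 1)
  refine ⟨ρ, fun k => ?_, ?_, (coe_le_payoff_iff _ _ _).2 ⟨?_, fun ε hε => ⟨0, fun m => ?_⟩⟩⟩
  · by_cases h : n ∣ k + 1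
    · exact Or.inr (decide_eq_true (hdvd _ h))
    · exact Or.inl (decide_eq_true h)
  · exact decide_eq_true (hdvd 0 (dvd_zero n))
  · refine (parityWinning_iff _ _).2 ⟨false, by simp [infiniteMemoryGame], ?_,
      Eventually.of_forall fun _ => Nat.zero_le _⟩
    refine frequently_atTop.2 fun a => ⟨n * (a + 1) - 1, ?_, ?_⟩
    · have : 2 * (a + 1) ≤ n * (a + 1) := Nat.mul_le_mul_right _ hn
      omega
    · have : n * (a + 1) - 1 + 1 = n * (a + 1) :=
        Nat.sub_add_cancel (Nat.mul_pos (by omega) (by omega))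
      simp [ρ, this]
  · have hsum : infiniteMemoryGame.weightSum ρ m = m - (m / n : ℕ) := by
      induction m with
      | zero => simp [weightSum_zero]
      | succ m ih =>
        rw [weightSum_succ, ih, Nat.succ_div]
        by_cases h : n ∣ m + 1
        · simp only [infiniteMemoryGame, ρ, h]
          push_cast
          simp
        · simp only [infiniteMemoryGame, ρ, h]
          push_cast
          simp
          ring
    have h1 : ((m / n : ℕ) : ℝ) ≤ m / n := Nat.cast_div_le
    have h2 : (1 - 1 / (n : ℝ)) * m = m - m / n := by ring
    have h3 : 0 ≤ ε * m := by positivity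
    rw [hsum]
    nlinarith

/-- The play of a finite-memory strategy is ultimately periodic. -/
theorem exists_period_of_isFiniteMemory {V : Type*} [Finite V] {G : WeightedGameGraph V} {i : Player}
    {σ : G.Strategy i} (hσ : σ.IsFiniteMemory) (hi : ∀ q, G.owner q = i) {ρ : ℕ → V}
    (hρ : ∀ k, ρ (k + 1) = σ.move ((List.range k).map ρ) ⟨ρ k, hi _⟩) :
    ∃ N p, 0 < p ∧ ∀ m ≥ N, ρ (m + p) = ρ m := by
  have : Finite (Quotient σ.memorySetoid) := hσ
  -- Memory class and current state together determine the future, and some pair of them repeats.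
  obtain ⟨k, k', hne, heq⟩ := Finite.exists_ne_map_eq_of_infinite fun k =>
    ((Quotient.mk σ.memorySetoid ((List.range k).map ρ), ρ k) : Quotient σ.memorySetoid × V)
  wlog hlt : k < k' generalizing k k'
  · exact this k' k hne.symm heq.symm (by omega)
  obtain ⟨h1, h2⟩ := Prod.mk.inj heq
  have key : ∀ m, σ.memorySetoid ((List.range (k + m)).map ρ) ((List.range (k' + m)).map ρ) ∧
      ρ (k + m) = ρ (k' + m) := by
    intro m
    induction m with
    | zero => exact ⟨Quotient.exact h1, h2⟩
    | succ m ih =>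
      obtain ⟨ih1, ih2⟩ := ih
      refine ⟨fun γ q => ?_, ?_⟩
      · rw [← add_assoc, ← add_assoc, List.range_succ, List.range_succ, List.map_append,
          List.map_append, List.append_assoc, List.append_assoc, List.map_singleton,
          List.map_singleton, ih2]
        exact ih1 _ q
      · rw [← add_assoc, ← add_assoc, hρ, hρ]
        have := ih1 [] ⟨ρ (k + m), hi _⟩
        simp only [List.append_nil] at this
        rw [this]
        congr 2
  refine ⟨k, k' - k, by omega, fun m hm => ?_⟩
  have := (key (m - k)).2
  rw [show k + (m - k) = m by omega, show k' + (m - k) = m + (k' - k) by omega] at this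
  exact this.symm

theorem infiniteMemoryGame_not_isOptimalOneFrom (σ : infiniteMemoryGame.Strategy Player.one)
    (hσ : σ.IsFiniteMemory) : ¬ infiniteMemoryGame.IsOptimalOneFrom σ true := by
  intro hopt
  obtain ⟨ρ, hρ0, hρ⟩ := exists_outcome (fun γ p => σ.move γ ⟨p, rfl⟩) true
  have hρplay : infiniteMemoryGame.IsPlay ρ := fun k => by
    rw [hρ]; exact σ.edge_move _ ⟨ρ k, rfl⟩
  have hρout : ρ ∈ infiniteMemoryGame.outcomes σ true := ⟨hρplay, hρ0, fun k _ => hρ k⟩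
  have hpay : ∀ n : ℕ, 2 ≤ n → ((1 - 1 / n : ℝ) : EReal) ≤ infiniteMemoryGame.payoff ρ := by
    intro n hn
    obtain ⟨π, h1, h2, h3⟩ := infiniteMemoryGame_exists_play n hn
    calc ((1 - 1 / n : ℝ) : EReal) ≤ infiniteMemoryGame.payoff π := h3
      -- Player 2 never moves, so every play is consistent with every `τ`.
      _ ≤ infiniteMemoryGame.upperVal true := le_iInf fun τ =>
        le_iSup₂ (f := fun ρ _ => infiniteMemoryGame.payoff ρ) π ⟨h1, h2, fun _ h => Player.noConfusion h⟩
      _ = infiniteMemoryGame.lowerVal true := (infiniteMemoryGame.determined_and_optimal.1 true).symm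
      _ = infiniteMemoryGame.valOne σ true := hopt.symm
      _ ≤ infiniteMemoryGame.payoff ρ := iInf₂_le ρ hρout
  obtain ⟨N, p, hp, hper⟩ := exists_period_of_isFiniteMemory hσ (fun _ => rfl) hρ
  -- A play of period `p` through `false` has mean at most `1 - 1 / p`. Optimality demands `1 - 1 /
  -- (2 * p)`, and a tolerance of `1 / (4 * p)` still leaves a gap.
  obtain ⟨hpar, hmean⟩ := (coe_le_payoff_iff _ _ _).1 (hpay (2 * p) (by omega))
  obtain ⟨s, hs, hfreq, -⟩ := (parityWinning_iff _ _).1 hpar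
  have hs' : s = false := by
    cases s
    · rfl
    · simp [infiniteMemoryGame] at hs
  subst hs'
  obtain ⟨m, hm, hmf⟩ := frequently_atTop.1 hfreq N
  have hfalse : ∀ j, ρ (m + j * p) = false := by
    intro j
    induction j with
    | zero => simpa using hmf
    | succ j ih => rw [Nat.succ_mul, ← add_assoc, hper _ (by omega), ih]
  have hsum : ∀ j : ℕ, infiniteMemoryGame.weightSum ρ (m + j * p) ≤ m + j * (p - 1 : ℝ) := by
    intro j
    induction j with
    | zero => simpa using infiniteMemoryGame_weightSum_le ρ m
    | succ j ih =>
      obtain ⟨p', rfl⟩ : ∃ p', p = p' + 1 := ⟨p - 1, by omega⟩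
      have := infiniteMemoryGame_weightSum_succ_le (ρ := fun i => ρ (m + j * (p' + 1) + i))
        (hfalse j) p'
      rw [Nat.succ_mul, ← add_assoc, weightSum_add]
      push_cast at ih ⊢
      linarith
  have hp' : (0 : ℝ) < p := by exact_mod_cast hp
  obtain ⟨C, hC⟩ := hmean (1 / (4 * p)) (by positivity)
  obtain ⟨j, hj⟩ := exists_nat_gt (4 * (C + m))
  have h1 := (hC (m + j * p)).trans (hsum j)
  have h2 : (1 - 1 / ((2 * p : ℕ) : ℝ) - 1 / (4 * p)) * ((m + j * p : ℕ) : ℝ)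
      = m + j * p - 3 / 4 * (m / p) - 3 / 4 * j := by
    push_cast
    field_simp
    ring
  have h3 : (m : ℝ) / p ≤ m := div_le_self (Nat.cast_nonneg m) (by exact_mod_cast hp)
  have h4 : (0 : ℝ) ≤ m := Nat.cast_nonneg m
  rw [h2] at h1
  nlinarith

end MeanPayoffParityGame

theorem mainTheorem1 :
    (∀ (V : Type*) [Finite V] (G : MeanPayoffParityGame V),
      G.IsDetermined ∧
      (∃ σ : G.Strategy Player.one, G.IsOptimalOne σ) ∧
      (∃ τ : G.Strategy Player.two, τ.IsMemoryless ∧ G.IsOptimalTwo τ)) ∧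
    (∃ (V : Type) (_ : Finite V) (G : MeanPayoffParityGame V),
      (∀ q, G.owner q = Player.one) ∧
      ∃ q₀ : V, ∀ σ : G.Strategy Player.one, σ.IsFiniteMemory → ¬ G.IsOptimalOneFrom σ q₀) :=
  ⟨fun _ _ G => G.determined_and_optimal, Bool, inferInstance,
    MeanPayoffParityGame.infiniteMemoryGame, fun _ => rfl, true,
    MeanPayoffParityGame.infiniteMemoryGame_not_isOptimalOneFrom⟩
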